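/- Let $N\ge 1$ and $k$ be integers. For $M\ge 1$ let $M_k(\Gamma_0(M))$ be the complex vector space of modular forms of weight $k$ for $\Gamma_0(M)\subseteq \mathrm{SL}_2(\mathbb{Z})$, and write $f=\sum_{m\ge 0}c_m(f)q^m$, $q=e^{2\pi i\tau}$, for the Fourier expansion of $f\in M_k(\Gamma_0(M))$. For a prime $p\mid N$ let $i_p\colon M_k(\Gamma_0(N/p))\to M_k(\Gamma_0(N))$ be the level-raising map $(i_p g)(\tau)=g(p\tau)$, that is, $c_m(i_p g)=c_{m/p}(g)$ if $p\mid m$ and $c_m(i_p g)=0$ otherwise. For $m\ge 1$ prime to $N$ let $T_m$ be the Hecke operator $$(T_m f)(\tau)=m^{k-1}\sum_{ad=m}d^{-k}\sum_{b=0}^{d-1}f\!\left(\frac{a\tau+b}{d}\right).$$ Let $f\in M_k(\Gamma_0(N))$ be such that $c_m(f)=0$ for every $m\ge 0$ with $\gcd(m,N)=1$. Then there are forms $f_p\in M_k(\Gamma_0(N/p))$, one for each prime $p$ dividing $N$, such that $$f=\sum_{p\mid N}i_p(f_p).$$ Moreover, the $f_p$ can be chosen so that, in addition: if $f$ is a cusp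 form, then every $f_p$ is a cusp form; and if $f$ is a Hecke eigenform, i.e. $T_m f=\lambda_m f$ for all $m\ge 1$ prime to $N$, then every $f_p$ (which may be zero) satisfies $T_m f_p=\lambda_m f_p$ for all $m\ge 1$ prime to $N$. -/

import Mathlib

open UpperHalfPlane ModularForm CongruenceSubgroup
open scoped MatrixGroups ModularForm Pointwise

noncomputable section

/-- The matrix `[a, b; 0, d]` with nonzero natural numbers `a`, `d`, as an element of
`GL(2, ℝ)`. -/
def upperTri (a b d : ℕ) (ha : a ≠ 0) (hd : d ≠ 0) : GL (Fin 2) ℝ :=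
  Matrix.GeneralLinearGroup.mkOfDetNeZero !![(a : ℝ), (b : ℝ); 0, (d : ℝ)]
    (by simp [Matrix.det_fin_two, ha, hd])

theorem coe_upperTri (a b d : ℕ) (ha : a ≠ 0) (hd : d ≠ 0) :
    (upperTri a b d ha hd : Matrix (Fin 2) (Fin 2) ℝ) = !![(a : ℝ), (b : ℝ); 0, (d : ℝ)] := rfl

theorem det_upperTri (a b d : ℕ) (ha : a ≠ 0) (hd : d ≠ 0) :
    (upperTri a b d ha hd).det.val = (a : ℝ) * d := by
  rw [Matrix.GeneralLinearGroup.val_det_apply, coe_upperTri]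
  simp [Matrix.det_fin_two]

theorem det_upperTri_pos (a b d : ℕ) (ha : a ≠ 0) (hd : d ≠ 0) :
    0 < (upperTri a b d ha hd).det.val := by
  rw [det_upperTri]
  have := Nat.pos_of_ne_zero ha
  have := Nat.pos_of_ne_zero hd
  positivity

theorem coe_upperTri_smul (a b d : ℕ) (ha : a ≠ 0) (hd : d ≠ 0) (τ : ℍ) :
    ((upperTri a b d ha hd • τ : ℍ) : ℂ) = ((a : ℂ) * τ + b) / d := by
  rw [UpperHalfPlane.coe_smul_of_det_pos (det_upperTri_pos a b d ha hd)]
  simp [UpperHalfPlane.num, UpperHalfPlane.denom, coe_upperTri]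

theorem slash_upperTri (k : ℤ) (f : ℍ → ℂ) (a b d : ℕ) (ha : a ≠ 0) (hd : d ≠ 0) (τ : ℍ) :
    (f ∣[k] upperTri a b d ha hd) τ
      = ((a : ℂ) * d) ^ (k - 1) * (d : ℂ) ^ (-k) * f (upperTri a b d ha hd • τ) := by
  have h := det_upperTri_pos a b d ha hd
  rw [ModularForm.slash_apply, abs_of_pos h, UpperHalfPlane.σ, if_pos h, det_upperTri]
  simp [UpperHalfPlane.denom, coe_upperTri]
  ring

/-- The Hecke operator `T_m` in weight `k`, as an operator on functions on the upper half plane,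
given by the usual coset representatives:
`T_m f = ∑ f ∣[k] [a, b; 0, d]`, summed over `a * d = m` and `0 ≤ b < d`.
Since `f ∣[k] g = (det g)^(k - 1) (c τ + d)^(-k) f (g τ)`, this is
`(T_m f)(τ) = m^(k - 1) ∑ d^(-k) f ((a τ + b) / d)`.
On forms for `Γ₀(N)` it is the `m`-th Hecke operator at level `N` whenever `m` is prime to `N`. -/
def heckeOp (k : ℤ) (m : ℕ) (f : ℍ → ℂ) : ℍ → ℂ :=
  ∑ x : m.divisorsAntidiagonal, ∑ b ∈ Finset.range x.1.2,
    f ∣[k] upperTri x.1.1 b x.1.2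
      (Nat.left_ne_zero_of_mem_divisorsAntidiagonal x.2)
      (Nat.right_ne_zero_of_mem_divisorsAntidiagonal x.2)

/-- `f` is an eigenfunction of every Hecke operator `T_m` with `m` prime to `N`, the eigenvalue
of `T_m` being `lam m`. The zero form is allowed. -/
def IsHeckeEigen (N : ℕ) (k : ℤ) (f : ℍ → ℂ) (lam : ℕ → ℂ) : Prop :=
  ∀ m : ℕ, 0 < m → m.Coprime N → heckeOp k m f = lam m • f

theorem Gamma0_le_conj {d M N : ℕ} (hd : d ≠ 0) (h : d * M ∣ N) :
    ((Gamma0 N : Subgroup SL(2, ℤ)) : Subgroup (GL (Fin 2) ℝ)) ≤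
      ConjAct.toConjAct (upperTri d 0 1 hd one_ne_zero)⁻¹ •
        ((Gamma0 M : Subgroup SL(2, ℤ)) : Subgroup (GL (Fin 2) ℝ)) := by
  rintro _ ⟨γ, hγ, rfl⟩
  have hγ' : (N : ℤ) ∣ γ 1 0 := by
    rwa [SetLike.mem_coe, Gamma0_mem, ZMod.intCast_zmod_eq_zero_iff_dvd] at hγ
  obtain ⟨c, hc⟩ : ((d : ℤ) * M) ∣ γ 1 0 := dvd_trans (by exact_mod_cast h) hγ'
  have hdet := γ.det_coe
  rw [Matrix.det_fin_two] at hdet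
  let δ : SL(2, ℤ) := ⟨!![γ 0 0, d * γ 0 1; M * c, γ 1 1], by
    rw [Matrix.det_fin_two]; rw [hc] at hdet; simp; linear_combination hdet⟩
  rw [Subgroup.mem_pointwise_smul_iff_inv_smul_mem]
  refine ⟨δ, ?_, ?_⟩
  · rw [SetLike.mem_coe, Gamma0_mem, ZMod.intCast_zmod_eq_zero_iff_dvd]
    exact ⟨c, by simp [δ]⟩
  · rw [ConjAct.smul_def, ← ConjAct.toConjAct_inv, ConjAct.ofConjAct_toConjAct, inv_inv,
      eq_mul_inv_iff_mul_eq]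
    ext i j
    have hcR : ((γ 1 0 : ℤ) : ℝ) = d * M * c := by rw [hc]; push_cast; ring
    have e : ∀ (g : SL(2, ℤ)) (i j : Fin 2), Matrix.SpecialLinearGroup.mapGL ℝ g i j = (g i j : ℝ) :=
      fun _ _ _ => rfl
    have h00 : δ 0 0 = γ 0 0 := rfl
    have h01 : δ 0 1 = d * γ 0 1 := rfl
    have h10 : δ 1 0 = M * c := rfl
    have h11 : δ 1 1 = γ 1 1 := rfl
    simp only [Units.val_mul, coe_upperTri, Matrix.mul_apply, Fin.sum_univ_two, e]
    fin_cases i <;> fin_cases j <;> simp [h00, h01, h10, h11, hcR] <;> ring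

/-- The level-raising map `i_d : M_k(Γ₀(M)) → M_k(Γ₀(N))`, for `d * M ∣ N`: it sends `f` to the
form `τ ↦ f (d τ)`, that is `d^(1 - k) f ∣[k] [d, 0; 0, 1]`; on `q`-expansions it is `q ↦ q^d`. -/
def levelRaise {d M N : ℕ} {k : ℤ} (hd : d ≠ 0) (h : d * M ∣ N)
    (f : ModularForm (Gamma0 M) k) : ModularForm (Gamma0 N) k :=
  (d : ℂ) ^ (1 - k) •
    { toFun := (f : ℍ → ℂ) ∣[k] upperTri d 0 1 hd one_ne_zero
      slash_action_eq' := fun γ hγ =>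
        (ModularForm.translate f (upperTri d 0 1 hd one_ne_zero)).slash_action_eq' γ
          (Gamma0_le_conj hd h hγ)
      holo' := (ModularForm.translate f (upperTri d 0 1 hd one_ne_zero)).holo'
      bdd_at_cusps' := fun hc =>
        (ModularForm.translate f (upperTri d 0 1 hd one_ne_zero)).bdd_at_cusps'
          (hc.mono (Gamma0_le_conj hd h)) }

theorem levelRaise_apply {d M N : ℕ} {k : ℤ} (hd : d ≠ 0) (h : d * M ∣ N)
    (f : ModularForm (Gamma0 M) k) (τ : ℍ) :
    levelRaise hd h f τ = f (upperTri d 0 1 hd one_ne_zero • τ) := by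
  change (d : ℂ) ^ (1 - k) * ((f : ℍ → ℂ) ∣[k] upperTri d 0 1 hd one_ne_zero) τ = _
  have hd' : (d : ℂ) ≠ 0 := by exact_mod_cast hd
  rw [slash_upperTri, ← mul_assoc, ← mul_assoc]
  simp only [Nat.cast_one, mul_one, one_zpow]
  rw [← zpow_add₀ hd']
  simp

/-- The effect of `i_d` on Fourier coefficients: `c_m(i_d f)` is `c_{m/d}(f)` if `d ∣ m`, and `0`
otherwise. -/
theorem coeff_levelRaise {d M N : ℕ} {k : ℤ} (hd : d ≠ 0) (h : d * M ∣ N)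
    (f : ModularForm (Gamma0 M) k) (m : ℕ) :
    (qExpansion 1 (levelRaise hd h f)).coeff m
      = if d ∣ m then (qExpansion 1 f).coeff (m / d) else 0 := by
  symm
  refine ModularFormClass.qExpansion_coeff_unique
    (c := fun m => if d ∣ m then (qExpansion 1 f).coeff (m / d) else 0) one_pos
    (Γ := (Gamma0 N : Subgroup SL(2, ℤ))) (k := k) (by simp) (fun τ => ?_) m
  rw [levelRaise_apply]
  have : Fact (IsCusp .infty ((Gamma0 M : Subgroup SL(2, ℤ)) : Subgroup (GL (Fin 2) ℝ))) :=
    ⟨Subgroup.isCusp_of_mem_strictPeriods (h := 1) one_pos (by simp)⟩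
  have key := ModularForm.hasSum_qExpansion f (h := 1) one_pos (by simp)
    (upperTri d 0 1 hd one_ne_zero • τ)
  have hinj : Function.Injective (fun n : ℕ => d * n) := fun x y hxy =>
    Nat.eq_of_mul_eq_mul_left (Nat.pos_of_ne_zero hd) hxy
  rw [← hinj.hasSum_iff]
  · convert key using 2 with n
    simp only [Function.comp, dvd_mul_right, if_true,
      Nat.mul_div_cancel_left n (Nat.pos_of_ne_zero hd), coe_upperTri_smul, pow_mul]
    congr 2
    simp only [Function.Periodic.qParam, ← Complex.exp_nat_mul]
    congr 1
    push_cast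
    ring
  · intro x hx
    have : ¬ d ∣ x := fun ⟨n, hn⟩ => hx ⟨n, hn.symm⟩
    simp [this]

end

/-! Conjugation by `[1, 0; 0, N]` turns Γ₀(N) into Γ⁰(N) and q into q^(1/N). Translations by
multiples of N/p then lie in SL(2, ℤ), and the average A_p over them (`translationAverage`) projects
onto the exponents divisible by p. The hypothesis on f therefore says that the product of the 1 -
A_p over p ∣ N kills f (`sieve_slash_scaleMatrix_eq_zero`).

Primes are removed one at a time (`exists_isOldComponent`). Let M = N/p and let E be the normalized
trace of f from Γ⁰(N) to Γ⁰(M). If p ∣ M, the translations represent all cosets and E = A_p f.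
Otherwise there is one more coset, that of w = `partialInversion e`, and E|w = E gives (1 - A_p) f =
(f - E) + p⁻¹ (f - E)|w. Modulo Γ(N), w commutes with the translations attached to the other primes.
Hence, if S is the rest of the sieve, h = S(f - E) satisfies h|w = -p h. But w has finite order
modulo Γ(N), which fixes h, so h = 0. Thus S kills f - E, and induction writes f as a sum of traces
of successive remainders.

Conjugated back, the trace belonging to p is i_p of a form of level N/p. A trace is a combination of
SL(2, ℤ)-translates, so it keeps holomorphy and the conditions at the cusps; it commutes with T_m
for m prime to N (`heckeScaled_sum_transversal`), so it keeps eigenvalues. -/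

/-! ### Coset representatives and traces -/

/-- Counting: `r` meets every coset in `Δ` and `s` meets none twice. Both have the same finite index
type, so matching cosets gives a permutation of the indices. -/
theorem sum_eq_sum_of_transversal {G A ι : Type*} [Group G] [AddCommMonoid A] [Fintype ι]
    (H : Subgroup G) (Δ : Set G) (r s : ι → G)
    (hr : ∀ x ∈ Δ, ∃ i, ∃ h ∈ H, x = h * r i) (hs : ∀ i, s i ∈ Δ)
    (hinj : ∀ i j, ∀ h ∈ H, s i = h * s j → i = j)
    (F : G → A) (hF : ∀ h ∈ H, ∀ x, F (h * x) = F x) :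
    ∑ i, F (s i) = ∑ i, F (r i) := by
  choose φ ε hε hφ using fun i => hr (s i) (hs i)
  have hinj' : Function.Injective φ := fun i j hij => by
    refine hinj i j (ε i * (ε j)⁻¹) (H.mul_mem (hε i) (H.inv_mem (hε j))) ?_
    rw [mul_assoc, hφ i, hφ j, hij]
    group
  rw [← (Equiv.ofBijective φ (Finite.injective_iff_bijective.mp hinj')).sum_comp
    fun i => F (r i)]
  refine Finset.sum_congr rfl fun i _ => ?_
  rw [hφ i, hF _ (hε i)]
  rfl

/-- The group `Γ⁰(N)` of matrices in `SL(2, ℤ)` whose upper right entry is divisible by `N`. -/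
def GammaUpper (N : ℕ) : Subgroup SL(2, ℤ) where
  carrier := {γ | (N : ℤ) ∣ γ 0 1}
  one_mem' := by simp
  mul_mem' {a b} ha hb := by
    have : (a * b) 0 1 = a 0 0 * b 0 1 + a 0 1 * b 1 1 := by
      simp [Matrix.mul_apply, Fin.sum_univ_two]
    rw [Set.mem_ofPred_eq, this]
    exact dvd_add (Dvd.dvd.mul_left hb _) (Dvd.dvd.mul_right ha _)
  inv_mem' {a} ha := by
    have : a⁻¹ 0 1 = - a 0 1 := by simp [Matrix.SpecialLinearGroup.SL2_inv_expl]
    rw [Set.mem_ofPred_eq, this]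
    exact (dvd_neg).mpr ha

theorem mem_GammaUpper {N : ℕ} {γ : SL(2, ℤ)} : γ ∈ GammaUpper N ↔ (N : ℤ) ∣ γ 0 1 := Iff.rfl

theorem GammaUpper_anti {M N : ℕ} (h : M ∣ N) : GammaUpper N ≤ GammaUpper M := fun _ hγ =>
  (Int.natCast_dvd_natCast.mpr h).trans hγ

/-- Invariance under the weight `k` slash action of a set of matrices in `SL(2, ℤ)`. -/
def SlashInvariantOn (k : ℤ) (H : Subgroup SL(2, ℤ)) (f : ℍ → ℂ) : Prop :=
  ∀ γ ∈ H, f ∣[k] γ = f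

/-- A finite family of representatives of `H \ H'`. -/
structure IsTransversal {G ι : Type*} [Group G] (H H' : Subgroup G) (r : ι → G) : Prop where
  mem : ∀ i, r i ∈ H'
  exists_eq : ∀ x ∈ H', ∃ i, ∃ h ∈ H, x = h * r i
  inj : ∀ i j, ∀ h ∈ H, r i = h * r j → i = j

theorem SlashInvariantOn.sum_transversal {ι : Type*} [Fintype ι] {k : ℤ} {f : ℍ → ℂ}
    {H H' : Subgroup SL(2, ℤ)} {r : ι → SL(2, ℤ)} (hr : IsTransversal H H' r)
    (hf : SlashInvariantOn k H f) : SlashInvariantOn k H' (∑ i, f ∣[k] r i) := by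
  intro γ hγ
  rw [SlashAction.sum_slash]
  simp only [← SlashAction.slash_mul]
  refine sum_eq_sum_of_transversal H H' r (fun i => r i * γ) hr.exists_eq
    (fun i => H'.mul_mem (hr.mem i) hγ) (fun i j h hh e => hr.inj i j h hh ?_)
    (fun x => f ∣[k] x) fun h hh x => ?_
  · simpa only [← mul_assoc, mul_left_inj] using e
  · simp only [SlashAction.slash_mul, hf h hh]

/-! ### Hecke operators on Γ⁰(N) -/

/-- The index set `{(a, d, b) : a * d = m, 0 ≤ b < d}` of the coset representatives of the Hecke
operator `T_m`. -/
abbrev HeckeIndex (m : ℕ) : Type := Σ x : m.divisorsAntidiagonal, Fin x.1.2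

/-- The coset representatives `[a, c * b; 0, d]`. -/
noncomputable def heckeRep {m : ℕ} (c : ℕ) (i : HeckeIndex m) : GL (Fin 2) ℝ :=
  upperTri i.1.1.1 (c * i.2) i.1.1.2
    (Nat.left_ne_zero_of_mem_divisorsAntidiagonal i.1.2)
    (Nat.right_ne_zero_of_mem_divisorsAntidiagonal i.1.2)

/-- The operator `∑ f ∣[k] [a, c * b; 0, d]`, which is the Hecke operator `T_m` on forms of
period `c`. -/
noncomputable def heckeScaled (k : ℤ) (m c : ℕ) (f : ℍ → ℂ) : ℍ → ℂ :=
  ∑ i : HeckeIndex m, f ∣[k] heckeRep c i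

theorem heckeOp_eq_heckeScaled (k : ℤ) (m : ℕ) (f : ℍ → ℂ) :
    heckeOp k m f = heckeScaled k m 1 f := by
  rw [heckeOp, heckeScaled, Fintype.sum_sigma]
  refine Finset.sum_congr rfl fun x _ => ?_
  rw [Finset.sum_range]
  simp [heckeRep]

theorem heckeIndex_mul {m : ℕ} (i : HeckeIndex m) : i.1.1.1 * i.1.1.2 = m :=
  (Nat.mem_divisorsAntidiagonal.mp i.1.2).1

theorem coe_heckeRep {m : ℕ} (c : ℕ) (i : HeckeIndex m) :
    (heckeRep c i : Matrix (Fin 2) (Fin 2) ℝ)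
      = (!![(i.1.1.1 : ℤ), (c * (i.2 : ℕ) : ℤ); 0, (i.1.1.2 : ℤ)]).map (Int.cast : ℤ → ℝ) := by
  rw [heckeRep, coe_upperTri]
  ext i j
  fin_cases i <;> fin_cases j <;> simp

theorem det_heckeRep_pos {m : ℕ} (c : ℕ) (i : HeckeIndex m) : 0 < (heckeRep c i).det.val :=
  det_upperTri_pos _ _ _ _ _

/-- The integral matrices of determinant `m` with upper right entry divisible by `M`. -/
def heckeSet (M m : ℕ) : Set (GL (Fin 2) ℝ) :=
  {g | ∃ A : Matrix (Fin 2) (Fin 2) ℤ, (g : Matrix (Fin 2) (Fin 2) ℝ) = A.map (Int.cast : ℤ → ℝ) ∧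
    A.det = m ∧ (M : ℤ) ∣ A 0 1}

theorem coe_mapGL_eq (γ : SL(2, ℤ)) :
    ((Matrix.SpecialLinearGroup.mapGL ℝ γ : GL (Fin 2) ℝ) : Matrix (Fin 2) (Fin 2) ℝ)
      = (γ : Matrix (Fin 2) (Fin 2) ℤ).map (Int.cast : ℤ → ℝ) := rfl

theorem map_intCast_mul (A B : Matrix (Fin 2) (Fin 2) ℤ) :
    (A * B).map (Int.cast : ℤ → ℝ) = A.map Int.cast * B.map Int.cast :=
  Matrix.map_mul (f := Int.castRingHom ℝ)

theorem map_intCast_injective {A B : Matrix (Fin 2) (Fin 2) ℤ}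
    (h : A.map (Int.cast : ℤ → ℝ) = B.map Int.cast) : A = B :=
  Matrix.map_injective Int.cast_injective h

theorem heckeRep_mul_mem {M c m : ℕ} (hM : M ∣ c) (i : HeckeIndex m) {γ : SL(2, ℤ)}
    (hγ : γ ∈ GammaUpper M) :
    heckeRep c i * Matrix.SpecialLinearGroup.mapGL ℝ γ ∈ heckeSet M m := by
  refine ⟨!![(i.1.1.1 : ℤ), (c * (i.2 : ℕ) : ℤ); 0, (i.1.1.2 : ℤ)] * γ, ?_, ?_, ?_⟩
  · rw [map_intCast_mul, Units.val_mul, coe_heckeRep, coe_mapGL_eq]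
  · rw [Matrix.det_mul, γ.det_coe, Matrix.det_fin_two]
    simpa using mod_cast heckeIndex_mul i
  · simp only [Matrix.mul_apply, Fin.sum_univ_two]
    exact dvd_add (Dvd.dvd.mul_left hγ _) (Dvd.dvd.mul_right
      (show (M : ℤ) ∣ c * (i.2 : ℕ) from
        Dvd.dvd.mul_right (Int.natCast_dvd_natCast.mpr hM) _) _)

/-- Hermite normal form under row operations: `a` is the gcd of the first column. The upper right
entry matters only modulo `d`, and since `c` is invertible modulo `d` it can be taken of the form `c
* b`. -/
theorem exists_mapGL_mul_heckeRep {M c m : ℕ} (hm : 0 < m) (hM : M ∣ c) (hc : m.Coprime c)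
    {x : GL (Fin 2) ℝ} (hx : x ∈ heckeSet M m) :
    ∃ i : HeckeIndex m, ∃ γ ∈ GammaUpper M,
      x = Matrix.SpecialLinearGroup.mapGL ℝ γ * heckeRep c i := by
  obtain ⟨A, hxA, hdet, hAM⟩ := hx
  rw [Matrix.det_fin_two] at hdet
  set g := Int.gcd (A 0 0) (A 1 0) with hg
  have hg0 : g ≠ 0 := by
    intro h0
    obtain ⟨h1, h2⟩ := Int.gcd_eq_zero_iff.mp (hg ▸ h0)
    rw [h1, h2] at hdet
    simp at hdet
    omega
  obtain ⟨u, hu⟩ : (g : ℤ) ∣ A 0 0 := Int.gcd_dvd_left ..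
  obtain ⟨v, hv⟩ : (g : ℤ) ∣ A 1 0 := Int.gcd_dvd_right ..
  have hbez : (g : ℤ) = A 0 0 * Int.gcdA (A 0 0) (A 1 0) + A 1 0 * Int.gcdB (A 0 0) (A 1 0) :=
    Int.gcd_eq_gcd_ab _ _
  set s := Int.gcdA (A 0 0) (A 1 0)
  set t := Int.gcdB (A 0 0) (A 1 0)
  have hgz : (g : ℤ) ≠ 0 := by exact_mod_cast hg0
  have huv : u * s + v * t = 1 := by
    apply mul_left_cancel₀ hgz
    rw [hu, hv] at hbez
    linear_combination -hbez
  set D := u * A 1 1 - v * A 0 1 with hD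
  have hgD : (g : ℤ) * D = m := by rw [← hdet, hD, hu, hv]; ring
  have hDpos : 0 < D := by
    have h1 : (0 : ℤ) < g := by positivity
    have h2 : 0 < (g : ℤ) * D := by rw [hgD]; exact_mod_cast hm
    exact pos_of_mul_pos_right h2 h1.le
  obtain ⟨d, hd⟩ := Int.eq_ofNat_of_zero_le hDpos.le
  have hgd : g * d = m := by rw [hd] at hgD; exact_mod_cast hgD
  have hdpos : 0 < d := by rw [hd] at hDpos; exact_mod_cast hDpos
  -- The coefficient `y` below inverts `c` modulo `d`, so `b = y * B mod d` solves `c * b ≡ B`.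
  have hcd : IsCoprime (c : ℤ) d := by
    rw [Nat.isCoprime_iff_coprime]
    exact (Nat.Coprime.coprime_dvd_left ⟨g, by rw [← hgd, mul_comm]⟩ hc).symm
  obtain ⟨y, z, hyz⟩ := hcd
  set B := s * A 0 1 + t * A 1 1 with hB
  set b := (y * B) % d with hb
  have hb0 : 0 ≤ b := Int.emod_nonneg _ (by positivity)
  have hbd : b < d := Int.emod_lt_of_pos _ (by positivity)
  obtain ⟨b', hb'⟩ := Int.eq_ofNat_of_zero_le hb0
  have hb'd : b' < d := by rw [hb'] at hbd; exact_mod_cast hbd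
  set e := y * B / d
  have hbe : b = y * B - d * e := by rw [hb, Int.emod_def]
  -- `B = c * b + d * n`
  set n := z * B + c * e with hn
  have hBn : B = c * b + d * n := by rw [hn, hbe]; linear_combination -B * hyz
  let i : HeckeIndex m := ⟨⟨(g, d), Nat.mem_divisorsAntidiagonal.mpr ⟨hgd, hm.ne'⟩⟩, ⟨b', hb'd⟩⟩
  have hA01 : A 0 1 = u * B - t * D := by rw [hB, hD]; linear_combination -(A 0 1) * huv
  have hA11 : A 1 1 = v * B + s * D := by rw [hB, hD]; linear_combination -(A 1 1) * huv
  let γ : SL(2, ℤ) := ⟨!![u, u * n - t; v, v * n + s], by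
    rw [Matrix.det_fin_two]; simp; linear_combination huv⟩
  refine ⟨i, γ, ?_, ?_⟩
  · rw [mem_GammaUpper]
    change (M : ℤ) ∣ u * n - t
    -- Only `d` times the entry is visible in `A 0 1`; `d` is then cancelled because it is prime to
    -- `M`.
    have h1 : (M : ℤ) ∣ (u * n - t) * d := by
      have : (u * n - t) * d = A 0 1 - u * (c * b) := by rw [hA01, hBn, hd]; ring
      rw [this]
      exact dvd_sub hAM (Dvd.dvd.mul_left (Dvd.dvd.mul_right (Int.natCast_dvd_natCast.mpr hM) _) _)
    refine IsCoprime.dvd_of_dvd_mul_right ?_ h1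
    rw [Nat.isCoprime_iff_coprime]
    exact Nat.Coprime.coprime_dvd_left hM
      (Nat.Coprime.coprime_dvd_left ⟨g, by rw [← hgd, mul_comm]⟩ hc).symm
  · apply Units.ext
    rw [hxA, Units.val_mul, coe_heckeRep, coe_mapGL_eq, ← map_intCast_mul]
    congr 1
    have hd' : D = (d : ℤ) := hd
    have hb'' : (b' : ℤ) = b := hb'.symm
    ext i' j'
    fin_cases i' <;> fin_cases j' <;>
      simp [γ, i, Matrix.mul_apply, Fin.sum_univ_two, hb'']
    · rw [hu]; ring
    · rw [hA01, hBn, hd']; ring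
    · rw [hv]; ring
    · rw [hA11, hBn, hd']; ring

/-- The vanishing lower left entry makes `γ` upper triangular, and positivity makes its diagonal 1.
Then `d` divides `c * (b - b')`, hence `b - b'`. -/
theorem heckeRep_injective_mod {c m : ℕ} (hc : m.Coprime c) {i j : HeckeIndex m} {γ : SL(2, ℤ)}
    (h : heckeRep c i = Matrix.SpecialLinearGroup.mapGL ℝ γ * heckeRep c j) : i = j := by
  have h' := congrArg (fun g : GL (Fin 2) ℝ => (g : Matrix (Fin 2) (Fin 2) ℝ)) h
  simp only [Units.val_mul, coe_heckeRep, coe_mapGL_eq, ← map_intCast_mul] at h'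
  replace h' := map_intCast_injective h'
  have hdet := γ.det_coe
  rw [Matrix.det_fin_two] at hdet
  obtain ⟨⟨⟨a, d⟩, had⟩, ⟨b, hb⟩⟩ := i
  obtain ⟨⟨⟨a', d'⟩, had'⟩, ⟨b', hb'⟩⟩ := j
  have h00 := congrFun (congrFun h' 0) 0
  have h01 := congrFun (congrFun h' 0) 1
  have h10 := congrFun (congrFun h' 1) 0
  have h11 := congrFun (congrFun h' 1) 1
  simp [Matrix.mul_apply, Fin.sum_univ_two] at h00 h01 h10 h11 hb hb'
  have ha' := Nat.left_ne_zero_of_mem_divisorsAntidiagonal had'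
  have hd := Nat.right_ne_zero_of_mem_divisorsAntidiagonal had
  have ha := Nat.left_ne_zero_of_mem_divisorsAntidiagonal had
  simp at ha' hd ha
  have hz : γ 1 0 = 0 := by
    rcases h10 with h | h
    · exact h
    · exact absurd h ha'
  rw [hz] at hdet h11
  have h1 : γ 0 0 * γ 1 1 = 1 := by simpa using hdet
  have hpos : 0 < γ 0 0 := by
    have h2 : (0 : ℤ) < γ 0 0 * a' := by rw [← h00]; positivity
    exact pos_of_mul_pos_left h2 (by positivity)
  have hone : γ 0 0 = 1 ∧ γ 1 1 = 1 := by
    rcases Int.mul_eq_one_iff_eq_one_or_neg_one.mp h1 with h | h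
    · exact h
    · omega
  rw [hone.1, one_mul] at h00
  rw [hone.2] at h11
  rw [hone.1] at h01
  have hdd : d = d' := by exact_mod_cast (by simpa using h11)
  have haa : a = a' := by exact_mod_cast h00
  subst hdd haa
  have hcd : IsCoprime (d : ℤ) c := by
    rw [Nat.isCoprime_iff_coprime]
    exact Nat.Coprime.coprime_dvd_left
      ⟨a, by rw [mul_comm]; exact (Nat.mem_divisorsAntidiagonal.mp had).1.symm⟩ hc
  have hdvd : (d : ℤ) ∣ (b : ℤ) - b' := by
    refine hcd.dvd_of_dvd_mul_left ⟨γ 0 1, ?_⟩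
    linear_combination h01
  have hbb : b = b' := by
    have h3 := Int.eq_zero_of_abs_lt_dvd hdvd (by rw [abs_lt]; constructor <;> omega)
    omega
  subst hbb
  rfl

/-- Modulo `N` the upper right entry of the equation reads `a * ρ 0 1 ≡ 0`, with `a` prime to `N`.
-/
theorem mem_GammaUpper_of_heckeRep_mul {N m : ℕ} (hm : m.Coprime N) {i j : HeckeIndex m}
    {ρ γ : SL(2, ℤ)} (hγ : γ ∈ GammaUpper N)
    (h : heckeRep N i * Matrix.SpecialLinearGroup.mapGL ℝ ρ
      = Matrix.SpecialLinearGroup.mapGL ℝ γ * heckeRep N j) : ρ ∈ GammaUpper N := by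
  have h' := congrArg (fun g : GL (Fin 2) ℝ => (g : Matrix (Fin 2) (Fin 2) ℝ)) h
  simp only [Units.val_mul, coe_heckeRep, coe_mapGL_eq, ← map_intCast_mul] at h'
  replace h' := map_intCast_injective h'
  have h01 := congrFun (congrFun h' 0) 1
  simp [Matrix.mul_apply, Fin.sum_univ_two] at h01
  obtain ⟨t, ht⟩ := mem_GammaUpper.mp hγ
  have hco : IsCoprime (N : ℤ) i.1.1.1 := by
    rw [Nat.isCoprime_iff_coprime]
    exact (Nat.Coprime.coprime_dvd_left ⟨_, (heckeIndex_mul i).symm⟩ hm).symm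
  refine hco.dvd_of_dvd_mul_left
    ⟨γ 0 0 * (j.2 : ℕ) + t * j.1.1.2 - (i.2 : ℕ) * ρ 1 1, ?_⟩
  rw [ht] at h01
  linear_combination h01

theorem heckeScaled_smul (k : ℤ) (m c : ℕ) (a : ℂ) (f : ℍ → ℂ) :
    heckeScaled k m c (a • f) = a • heckeScaled k m c f := by
  rw [heckeScaled, heckeScaled, Finset.smul_sum]
  refine Finset.sum_congr rfl fun i _ => ?_
  rw [ModularForm.smul_slash, UpperHalfPlane.σ, if_pos (det_heckeRep_pos c i)]
  rfl

theorem heckeScaled_sum {ι : Type*} (k : ℤ) (m c : ℕ) (s : Finset ι) (f : ι → ℍ → ℂ) :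
    heckeScaled k m c (∑ i ∈ s, f i) = ∑ i ∈ s, heckeScaled k m c (f i) := by
  simp only [heckeScaled, SlashAction.sum_slash]
  exact Finset.sum_comm

theorem slash_mapGL_mul {k : ℤ} {H : Subgroup SL(2, ℤ)} {f : ℍ → ℂ} (hf : SlashInvariantOn k H f)
    (h : GL (Fin 2) ℝ) (hh : h ∈ H.map (Matrix.SpecialLinearGroup.mapGL ℝ)) (x : GL (Fin 2) ℝ) :
    f ∣[k] (h * x) = f ∣[k] x := by
  obtain ⟨γ, hγ, rfl⟩ := hh
  rw [SlashAction.slash_mul]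
  congr 1
  exact hf γ hγ

theorem heckeScaled_eq_of_dvd {k : ℤ} {M c m : ℕ} (hm : 0 < m) (hc : m.Coprime c) (hM : M ∣ c)
    {f : ℍ → ℂ} (hf : SlashInvariantOn k (GammaUpper M) f) :
    heckeScaled k m c f = heckeScaled k m M f := by
  have hmM : m.Coprime M := Nat.Coprime.coprime_dvd_right hM hc
  refine sum_eq_sum_of_transversal ((GammaUpper M).map (Matrix.SpecialLinearGroup.mapGL ℝ))
    (heckeSet M m) (heckeRep M) (heckeRep c) (fun x hx => ?_) (fun i => ?_) ?_
    (fun x => f ∣[k] x) (slash_mapGL_mul hf)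
  · obtain ⟨i, γ, hγ, h⟩ := exists_mapGL_mul_heckeRep hm dvd_rfl hmM hx
    exact ⟨i, _, ⟨γ, hγ, rfl⟩, h⟩
  · simpa using heckeRep_mul_mem hM i (one_mem (GammaUpper M))
  · rintro i j _ ⟨γ, -, rfl⟩ h
    exact heckeRep_injective_mod hc h

/-- Both orders of multiplying the Hecke and trace representatives give representatives of Γ⁰(N) \
`heckeSet M m`: one order is shown to cover, the other to be free of repetitions. -/
theorem heckeScaled_sum_transversal {ι : Type*} [Fintype ι] {k : ℤ} {M N m : ℕ} (hm : 0 < m)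
    (hN : m.Coprime N) (hM : M ∣ N) {r : ι → SL(2, ℤ)}
    (hr : IsTransversal (GammaUpper N) (GammaUpper M) r) {f : ℍ → ℂ}
    (hf : SlashInvariantOn k (GammaUpper N) f) :
    heckeScaled k m N (∑ i, f ∣[k] r i) = ∑ i, (heckeScaled k m N f) ∣[k] r i := by
  have key := sum_eq_sum_of_transversal (ι := ι × HeckeIndex m)
    ((GammaUpper N).map (Matrix.SpecialLinearGroup.mapGL ℝ)) (heckeSet M m)
    (fun x => Matrix.SpecialLinearGroup.mapGL ℝ (r x.1) * heckeRep N x.2)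
    (fun x => heckeRep N x.2 * Matrix.SpecialLinearGroup.mapGL ℝ (r x.1))
    ?_ ?_ ?_ (fun x => f ∣[k] x) (slash_mapGL_mul hf)
  · rw [heckeScaled_sum, Fintype.sum_prod_type, Fintype.sum_prod_type] at *
    simp only [heckeScaled, SlashAction.sum_slash]
    simp only [SlashAction.slash_mul] at key
    exact key.symm
  · intro x hx
    obtain ⟨j, γ, hγ, h⟩ := exists_mapGL_mul_heckeRep hm hM hN hx
    obtain ⟨i, ε, hε, rfl⟩ := hr.exists_eq γ hγ
    exact ⟨(i, j), _, ⟨ε, hε, rfl⟩, by rw [h, map_mul, mul_assoc]⟩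
  · exact fun x => heckeRep_mul_mem hM x.2 (hr.mem x.1)
  · rintro ⟨i, j⟩ ⟨i', j'⟩ _ ⟨ε, hε, rfl⟩ h
    simp only at h
    have h2 : heckeRep N j * Matrix.SpecialLinearGroup.mapGL ℝ (r i * (r i')⁻¹)
        = Matrix.SpecialLinearGroup.mapGL ℝ ε * heckeRep N j' := by
      rw [map_mul, map_inv, ← mul_assoc, h]
      group
    have h3 := mem_GammaUpper_of_heckeRep_mul hN hε h2
    obtain rfl : i = i' := hr.inj i i' _ h3 (by group)
    have h4 : heckeRep N j = Matrix.SpecialLinearGroup.mapGL ℝ ε * heckeRep N j' := by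
      simpa using h2
    rw [heckeRep_injective_mod hN h4]

/-! ### Representatives of Γ⁰(pM) in Γ⁰(M) -/

/-- The upper unipotent matrix `[1, t; 0, 1]`. -/
def upperUnip (t : ℤ) : SL(2, ℤ) := ⟨!![1, t; 0, 1], by simp [Matrix.det_fin_two]⟩

/-- The matrix `[1 - e², e³ - 2e; e, 1 - e²]`. It is congruent to `[0, -1; 1, 0]` modulo divisors of
`e - 1`, and to the identity modulo divisors of `e`. -/
def partialInversion (e : ℤ) : SL(2, ℤ) :=
  ⟨!![1 - e ^ 2, e ^ 3 - 2 * e; e, 1 - e ^ 2], by rw [Matrix.det_fin_two]; simp; ring⟩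

theorem coe_upperUnip (t : ℤ) : (upperUnip t : Matrix (Fin 2) (Fin 2) ℤ) = !![1, t; 0, 1] := rfl

theorem coe_partialInversion (e : ℤ) : (partialInversion e : Matrix (Fin 2) (Fin 2) ℤ)
    = !![1 - e ^ 2, e ^ 3 - 2 * e; e, 1 - e ^ 2] := rfl

theorem mul_upperUnip_apply (γ : SL(2, ℤ)) (t : ℤ) : (γ * upperUnip t) 0 1 = γ 0 0 * t + γ 0 1 := by
  simp [coe_upperUnip, Matrix.mul_apply, Fin.sum_univ_two]

theorem upperUnip_inv (t : ℤ) : (upperUnip t)⁻¹ = upperUnip (-t) := by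
  ext i j
  rw [Matrix.SpecialLinearGroup.coe_inv, coe_upperUnip, coe_upperUnip, Matrix.adjugate_fin_two]
  fin_cases i <;> fin_cases j <;> simp

theorem mul_partialInversion_inv_apply (γ : SL(2, ℤ)) (e : ℤ) :
    (γ * (partialInversion e)⁻¹) 0 1 = γ 0 1 * (1 - e ^ 2) - γ 0 0 * (e ^ 3 - 2 * e) := by
  rw [Matrix.SpecialLinearGroup.coe_mul, Matrix.SpecialLinearGroup.coe_inv, coe_partialInversion,
    Matrix.adjugate_fin_two, Matrix.mul_apply, Fin.sum_univ_two]
  simp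
  ring

theorem exists_eq_mul_upperUnip {p M : ℕ} (hp : p.Prime) {γ : SL(2, ℤ)}
    (hγ : γ ∈ GammaUpper M) (h : ¬ (p : ℤ) ∣ γ 0 0) :
    ∃ j : Fin p, ∃ ε ∈ GammaUpper (p * M), γ = ε * upperUnip ((j : ℕ) * M) := by
  obtain ⟨b, hb⟩ := mem_GammaUpper.mp hγ
  have hco : IsCoprime (γ 0 0) (p : ℤ) :=
    ((Nat.prime_iff_prime_int.mp hp).coprime_iff_not_dvd.mpr h).symm
  obtain ⟨y, z, hyz⟩ := hco
  have hp0 : (0 : ℤ) < p := by exact_mod_cast hp.pos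
  obtain ⟨j, hj⟩ := Int.eq_ofNat_of_zero_le (Int.emod_nonneg (y * b) hp0.ne')
  have hjp : j < p := by
    have := Int.emod_lt_of_pos (y * b) hp0
    rw [hj] at this
    exact_mod_cast this
  -- The residue `j` is `b / γ 0 0` modulo `p`, which makes `b - γ 0 0 * j` divisible by `p`.
  refine ⟨⟨j, hjp⟩, γ * (upperUnip (j * M))⁻¹, ?_, by simp⟩
  rw [mem_GammaUpper, upperUnip_inv, mul_upperUnip_apply, hb]
  have hj' : (j : ℤ) = y * b - p * (y * b / p) := by
    rw [← Int.emod_def]; exact hj.symm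
  refine ⟨z * b + γ 0 0 * (y * b / p), ?_⟩
  rw [hj']
  push_cast
  linear_combination -(M : ℤ) * b * hyz

theorem upperUnip_inj_mod {p M : ℕ} (hM : M ≠ 0) {i j : Fin p} {ε : SL(2, ℤ)}
    (hε : ε ∈ GammaUpper (p * M))
    (h : upperUnip ((i : ℕ) * M) = ε * upperUnip ((j : ℕ) * M)) : i = j := by
  have h1 : ε = upperUnip ((i : ℕ) * M) * (upperUnip ((j : ℕ) * M))⁻¹ := by rw [h]; group
  rw [mem_GammaUpper, h1, upperUnip_inv, mul_upperUnip_apply] at hε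
  have h2 : ((p : ℤ) * M) ∣ ((i : ℕ) - (j : ℕ) : ℤ) * M := by
    convert hε using 1
    · push_cast; ring
    · simp [upperUnip]; ring
  have h3 := Int.dvd_of_mul_dvd_mul_right (by exact_mod_cast hM) h2
  have h4 := Int.eq_zero_of_abs_lt_dvd h3 (by rw [abs_lt]; constructor <;> omega)
  ext
  omega

theorem upperUnip_mem_GammaUpper {M : ℕ} {t : ℤ} (h : (M : ℤ) ∣ t) : upperUnip t ∈ GammaUpper M :=
  h

theorem isTransversal_of_dvd {p M : ℕ} (hp : p.Prime) (hM : M ≠ 0) (hpM : p ∣ M) :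
    IsTransversal (GammaUpper (p * M)) (GammaUpper M)
      (fun j : Fin p => upperUnip ((j : ℕ) * M)) where
  mem j := upperUnip_mem_GammaUpper (dvd_mul_left _ _)
  exists_eq γ hγ := exists_eq_mul_upperUnip hp hγ fun h => by
    have h01 : (p : ℤ) ∣ γ 0 1 := (Int.natCast_dvd_natCast.mpr hpM).trans hγ
    have hdet := γ.det_coe
    rw [Matrix.det_fin_two] at hdet
    have : (p : ℤ) ∣ 1 := hdet ▸ dvd_sub (h.mul_right _) (h01.mul_right _)
    exact hp.one_lt.ne' (by exact_mod_cast Int.eq_one_of_dvd_one (by positivity) this)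
  inj i j ε hε h := upperUnip_inj_mod hM hε h

/-- The coset of `γ` is a point of the projective line over 𝔽_p: the translations give the points
with `γ 0 0` nonzero modulo `p`, and `partialInversion e` the remaining one. -/
theorem isTransversal_of_not_dvd {p M : ℕ} (hp : p.Prime) (hM : M ≠ 0) {e : ℤ}
    (hpM : ¬ p ∣ M) (hep : (p : ℤ) ∣ e - 1) (heM : (M : ℤ) ∣ e) :
    IsTransversal (GammaUpper (p * M)) (GammaUpper M)
      (fun j : Option (Fin p) => j.elim (partialInversion e) fun j => upperUnip ((j : ℕ) * M)) := by
  have hsq : (p : ℤ) ∣ 1 - e ^ 2 := by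
    obtain ⟨t, ht⟩ := hep
    exact ⟨-t * (1 + e), by linear_combination -(1 + e) * ht⟩
  have hcub : (M : ℤ) ∣ e ^ 3 - 2 * e := by
    obtain ⟨t, ht⟩ := heM
    exact ⟨t * (e ^ 2 - 2), by linear_combination (e ^ 2 - 2) * ht⟩
  have hp1 : ¬ (p : ℤ) ∣ 1 := fun h =>
    hp.one_lt.ne' (by exact_mod_cast Int.eq_one_of_dvd_one (by positivity) h)
  have hne : ∀ i : Fin p,
      upperUnip ((i : ℕ) * M) * (partialInversion e)⁻¹ ∉ GammaUpper (p * M) := by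
    intro i h
    rw [mem_GammaUpper, mul_partialInversion_inv_apply] at h
    have h1 : (p : ℤ) ∣ ((i : ℕ) * M : ℤ) * (1 - e ^ 2) - 1 * (e ^ 3 - 2 * e) :=
      (Int.natCast_dvd_natCast.mpr (dvd_mul_right p M)).trans h
    obtain ⟨t, ht⟩ := hep
    refine hp1 ?_
    have h2 := dvd_sub h1 (hsq.mul_left ((i : ℕ) * M : ℤ))
    -- This product is `e ^ 3 - 2 * e + 1`; adding it to `h2` leaves 1.
    have h3 : (p : ℤ) ∣ (e - 1) * (e ^ 2 + e - 1) := ⟨t * (e ^ 2 + e - 1), by rw [ht]; ring⟩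
    have h4 := dvd_add h2 h3
    ring_nf at h4
    exact h4
  constructor
  · rintro (_ | j)
    · exact hcub
    · exact upperUnip_mem_GammaUpper (dvd_mul_left _ _)
  · intro γ hγ
    by_cases h : (p : ℤ) ∣ γ 0 0
    · refine ⟨none, γ * (partialInversion e)⁻¹, ?_, by simp⟩
      rw [mem_GammaUpper, mul_partialInversion_inv_apply]
      push_cast
      refine IsCoprime.mul_dvd ?_ ?_ ?_
      · rw [Nat.isCoprime_iff_coprime]
        exact (Nat.Prime.coprime_iff_not_dvd hp).mpr hpM
      · exact dvd_sub (hsq.mul_left _) (h.mul_right _)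
      · exact dvd_sub (Dvd.dvd.mul_right hγ _) (hcub.mul_left _)
    · obtain ⟨j, ε, hε, hj⟩ := exists_eq_mul_upperUnip hp hγ h
      exact ⟨some j, ε, hε, hj⟩
  · rintro (_ | i) (_ | j) ε hε h
    · rfl
    · simp only [Option.elim] at h
      refine absurd ?_ (hne j)
      rw [h, mul_inv_rev, ← mul_assoc, mul_inv_cancel, one_mul]
      exact inv_mem hε
    · simp only [Option.elim] at h
      refine absurd ?_ (hne i)
      rw [h]
      simpa using hε
    · rw [upperUnip_inj_mod hM hε h]

/-! ### Invariance under Γ(N) -/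

variable {k : ℤ}

theorem SlashInvariantOn.mono {H H' : Subgroup SL(2, ℤ)} {f : ℍ → ℂ} (hH : H ≤ H')
    (hf : SlashInvariantOn k H' f) : SlashInvariantOn k H f := fun γ hγ => hf γ (hH hγ)

theorem SlashInvariantOn.sub {H : Subgroup SL(2, ℤ)} {f g : ℍ → ℂ}
    (hf : SlashInvariantOn k H f) (hg : SlashInvariantOn k H g) :
    SlashInvariantOn k H (f - g) := fun γ hγ => by
  rw [sub_eq_add_neg, SlashAction.add_slash, SlashAction.neg_slash, hf γ hγ, hg γ hγ]

theorem SlashInvariantOn.smul {H : Subgroup SL(2, ℤ)} {f : ℍ → ℂ}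
    (hf : SlashInvariantOn k H f) (c : ℂ) :
    SlashInvariantOn k H (c • f) := fun γ hγ => by
  rw [ModularForm.SL_smul_slash, hf γ hγ]

theorem SlashInvariantOn.sum {ι : Type*} {s : Finset ι} {H : Subgroup SL(2, ℤ)} {f : ι → ℍ → ℂ}
    (hf : ∀ i ∈ s, SlashInvariantOn k H (f i)) :
    SlashInvariantOn k H (∑ i ∈ s, f i) := fun γ hγ => by
  rw [SlashAction.sum_slash]
  exact Finset.sum_congr rfl fun i hi => hf i hi γ hγ

theorem SlashInvariantOn.slash {H : Subgroup SL(2, ℤ)} [hH : H.Normal] {f : ℍ → ℂ}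
    (hf : SlashInvariantOn k H f) (g : SL(2, ℤ)) : SlashInvariantOn k H (f ∣[k] g) := fun γ hγ => by
  rw [← SlashAction.slash_mul, show g * γ = g * γ * g⁻¹ * g by group, SlashAction.slash_mul,
    hf _ (hH.conj_mem γ hγ g)]

instance (N : ℕ) : (Gamma N).Normal := Gamma_normal N

theorem Gamma_le_GammaUpper (N : ℕ) : Gamma N ≤ GammaUpper N := fun γ hγ => by
  rw [mem_GammaUpper, ← ZMod.intCast_zmod_eq_zero_iff_dvd]
  exact (Gamma_mem.mp hγ).2.1

/-- The two products differ only by `e * t` on the diagonal, so they agree modulo `N`. -/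
theorem SlashInvariantOn.slash_partialInversion_slash_upperUnip {N : ℕ} {e t : ℤ}
    (h : (N : ℤ) ∣ e * t) {f : ℍ → ℂ} (hf : SlashInvariantOn k (Gamma N) f) :
    (f ∣[k] partialInversion e) ∣[k] upperUnip t = (f ∣[k] upperUnip t) ∣[k] partialInversion e := by
  rw [← SlashAction.slash_mul, ← SlashAction.slash_mul]
  have hmem : (partialInversion e * upperUnip t) * (upperUnip t * partialInversion e)⁻¹ ∈ Gamma N := by
    rw [Gamma_mem', map_mul, map_inv, mul_inv_eq_one]
    ext i j
    simp only [Matrix.SpecialLinearGroup.map_apply_coe, RingHom.mapMatrix_apply, Matrix.map_apply,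
      Int.coe_castRingHom]
    rw [ZMod.intCast_eq_intCast_iff_dvd_sub]
    obtain ⟨c, hc⟩ := h
    fin_cases i <;> fin_cases j <;>
      simp [coe_partialInversion, coe_upperUnip, Matrix.mul_apply, Fin.sum_univ_two]
    · exact ⟨c, by linear_combination hc⟩
    · ring_nf; simp
    · exact ⟨c, by linear_combination hc⟩
  rw [show partialInversion e * upperUnip t = partialInversion e * upperUnip t *
    (upperUnip t * partialInversion e)⁻¹ * (upperUnip t * partialInversion e) by group,
    SlashAction.slash_mul, hf _ hmem]

/-- The equation says `f ∣[k] g = -p • f`. Some positive power of `g` lies in Γ(N) and fixes `f`,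
whereas no positive power of `-p` is 1. -/
theorem SlashInvariantOn.eq_zero_of_add_smul_slash {N : ℕ} [NeZero N] {f : ℍ → ℂ}
    (hf : SlashInvariantOn k (Gamma N) f) (g : SL(2, ℤ)) {p : ℕ} (hp : 1 < p)
    (h : f + (p : ℂ)⁻¹ • (f ∣[k] g) = 0) : f = 0 := by
  have hp0 : (p : ℂ) ≠ 0 := by exact_mod_cast (by omega : p ≠ 0)
  have h1 : f ∣[k] g = (-p : ℂ) • f := by
    have h2 : (p : ℂ) • (f + (p : ℂ)⁻¹ • (f ∣[k] g)) = 0 := by rw [h, smul_zero]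
    rw [smul_add, smul_inv_smul₀ hp0] at h2
    rw [_root_.neg_smul]
    exact eq_neg_of_add_eq_zero_right h2
  have hpow : ∀ n : ℕ, f ∣[k] (g ^ n) = ((-p : ℂ) ^ n) • f := by
    intro n
    induction n with
    | zero => simp
    | succ n ih =>
      rw [pow_succ, SlashAction.slash_mul, ih, ModularForm.SL_smul_slash, h1, smul_smul, pow_succ]
  obtain ⟨n, hn, -, hgn⟩ := Subgroup.exists_pow_mem_of_index_ne_zero
    (H := Gamma N) Subgroup.FiniteIndex.index_ne_zero g
  have h3 := hpow n
  rw [hf _ hgn] at h3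
  by_contra hne
  have h4 : (1 : ℂ) = (-p : ℂ) ^ n := by
    refine smul_left_injective ℂ hne ?_
    simpa using h3
  have h5 := congrArg norm h4
  rw [norm_one, norm_pow, norm_neg, Complex.norm_natCast] at h5
  have h6 : 1 < (p : ℝ) ^ n := one_lt_pow₀ (by exact_mod_cast hp) (by omega)
  linarith

/-! ### The sieve -/

/-- The average of `f` over translations by multiples of `N / p`. On a `q`-expansion in `q^(1/N)`
it is the projection to the exponents divisible by `p`. -/
noncomputable def translationAverage (k : ℤ) (N p : ℕ) (f : ℍ → ℂ) : ℍ → ℂ :=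
  (p : ℂ)⁻¹ • ∑ j : Fin p, f ∣[k] upperUnip ((j : ℕ) * (N / p : ℕ))

/-- The successive application of the operators `1 - translationAverage k N p`. -/
noncomputable def sieve (k : ℤ) (N : ℕ) : List ℕ → (ℍ → ℂ) → (ℍ → ℂ)
  | [], f => f
  | p :: L, f => sieve k N L (f - translationAverage k N p f)

theorem translationAverage_add_smul (N p : ℕ) (f g : ℍ → ℂ) (c : ℂ) :
    translationAverage k N p (f + c • g)
      = translationAverage k N p f + c • translationAverage k N p g := by
  simp only [translationAverage, SlashAction.add_slash, ModularForm.SL_smul_slash,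
    Finset.sum_add_distrib, ← Finset.smul_sum, smul_add]
  rw [smul_comm]

theorem sieve_add_smul (N : ℕ) (L : List ℕ) (f g : ℍ → ℂ) (c : ℂ) :
    sieve k N L (f + c • g) = sieve k N L f + c • sieve k N L g := by
  induction L generalizing f g with
  | nil => rfl
  | cons p L ih =>
    rw [sieve, sieve, sieve, translationAverage_add_smul, ← ih]
    congr 1
    rw [smul_sub]
    abel

theorem SlashInvariantOn.translationAverage {H : Subgroup SL(2, ℤ)} [H.Normal] {f : ℍ → ℂ}
    (hf : SlashInvariantOn k H f) (N p : ℕ) :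
    SlashInvariantOn k H (translationAverage k N p f) :=
  .smul (.sum fun _ _ => hf.slash _) _

theorem SlashInvariantOn.sieve {H : Subgroup SL(2, ℤ)} [H.Normal] {f : ℍ → ℂ}
    (hf : SlashInvariantOn k H f) (N : ℕ) (L : List ℕ) :
    SlashInvariantOn k H (sieve k N L f) := by
  induction L generalizing f with
  | nil => exact hf
  | cons p L ih => exact ih (hf.sub (hf.translationAverage N p))

theorem SlashInvariantOn.sieve_slash_partialInversion {N : ℕ} {L : List ℕ} {e : ℤ}
    (he : ∀ q ∈ L, (N : ℤ) ∣ e * (N / q : ℕ)) {f : ℍ → ℂ} (hf : SlashInvariantOn k (Gamma N) f) :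
    _root_.sieve k N L (f ∣[k] partialInversion e)
      = (_root_.sieve k N L f) ∣[k] partialInversion e := by
  induction L generalizing f with
  | nil => rfl
  | cons q L ih =>
    rw [_root_.sieve, _root_.sieve, ← ih (fun q hq => he q (List.mem_cons_of_mem _ hq))
      (hf.sub (hf.translationAverage N q))]
    congr 1
    rw [sub_eq_add_neg, sub_eq_add_neg, SlashAction.add_slash, SlashAction.neg_slash]
    congr 2
    rw [_root_.translationAverage, _root_.translationAverage, ModularForm.SL_smul_slash,
      SlashAction.sum_slash]
    congr 1
    refine Finset.sum_congr rfl fun j _ => ?_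
    refine hf.slash_partialInversion_slash_upperUnip ?_
    have := he q List.mem_cons_self
    rw [mul_left_comm]
    exact this.mul_left _

/-! ### Splitting off one prime at a time -/

/-- A space of functions stable under the weight `k` action of `SL(2, ℤ)`. -/
def IsSlashStable (k : ℤ) (V : Submodule ℂ (ℍ → ℂ)) : Prop :=
  ∀ f ∈ V, ∀ γ : SL(2, ℤ), f ∣[k] γ ∈ V

/-- `e` is invariant under `Γ⁰(M)`, and inherits from `f` membership in the spaces stable under
`SL(2, ℤ)`, and Hecke eigenvalues at level `N`. -/
structure IsOldComponent (k : ℤ) (N M : ℕ) (f e : ℍ → ℂ) : Prop where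
  invariant : SlashInvariantOn k (GammaUpper M) e
  mem : ∀ V : Submodule ℂ (ℍ → ℂ), IsSlashStable k V → f ∈ V → e ∈ V
  hecke : ∀ m : ℕ, 0 < m → m.Coprime N → ∀ a : ℂ,
    heckeScaled k m N f = a • f → heckeScaled k m N e = a • e

theorem isOldComponent_sum_transversal {ι : Type*} [Fintype ι] {M N : ℕ} (hM : M ∣ N)
    {r : ι → SL(2, ℤ)} (hr : IsTransversal (GammaUpper N) (GammaUpper M) r) {f : ℍ → ℂ}
    (hf : SlashInvariantOn k (GammaUpper N) f) (c : ℂ) :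
    IsOldComponent k N M f (c • ∑ i, f ∣[k] r i) where
  invariant := (hf.sum_transversal hr).smul c
  mem V hV hfV := V.smul_mem _ (V.sum_mem fun i _ => hV f hfV _)
  hecke m hm hmN a h := by
    rw [heckeScaled_smul, heckeScaled_sum_transversal hm hmN hM hr hf, h]
    simp only [ModularForm.SL_smul_slash, ← Finset.smul_sum]
    rw [smul_comm]

theorem IsOldComponent.sub {M M' N : ℕ} {f g e : ℍ → ℂ}
    (h : IsOldComponent k N M f g) (he : IsOldComponent k N M' (f - g) e) :
    IsOldComponent k N M' f e where
  invariant := he.invariant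
  mem V hV hfV := he.mem V hV (V.sub_mem hfV (h.mem V hV hfV))
  hecke m hm hmN a ha := by
    refine he.hecke m hm hmN a ?_
    -- The difference is written as a finite sum so that `heckeScaled_sum` applies.
    have e1 : f - g = ∑ i : Bool, (if i then f else (-1 : ℂ) • g) := by simp [sub_eq_add_neg]
    rw [e1, heckeScaled_sum]
    simp only [Fintype.sum_bool, if_true, Bool.false_eq_true, if_false, heckeScaled_smul, ha,
      h.hecke m hm hmN a ha]
    rw [smul_add, smul_comm]

/-- When p² ∤ N the average is not Γ⁰(N/p)-invariant and the trace replaces it. The second clause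
says that the rest of the sieve does not notice the replacement. -/
theorem exists_isOldComponent {N p : ℕ} [NeZero N] (hp : p.Prime) (hpN : p ∣ N) {f : ℍ → ℂ}
    (hf : SlashInvariantOn k (GammaUpper N) f) :
    ∃ e, IsOldComponent k N (N / p) f e ∧
      ∀ L : List ℕ, (∀ q ∈ L, q.Prime ∧ q ∣ N ∧ q ≠ p) →
        sieve k N L (f - translationAverage k N p f) = 0 → sieve k N L (f - e) = 0 := by
  obtain ⟨M, rfl⟩ := hpN
  have hM0 : M ≠ 0 := fun h => NeZero.ne (p * M) (by simp [h])
  have hdiv : p * M / p = M := Nat.mul_div_cancel_left M hp.pos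
  have hMN : M ∣ p * M := dvd_mul_left _ _
  rw [hdiv]
  by_cases hpM : p ∣ M
  · refine ⟨translationAverage k (p * M) p f, ?_, fun L _ h => h⟩
    rw [translationAverage, hdiv]
    exact isOldComponent_sum_transversal hMN (isTransversal_of_dvd hp hM0 hpM) hf _
  · obtain ⟨x, y, hxy⟩ : IsCoprime (p : ℤ) M := by
      rw [Nat.isCoprime_iff_coprime]
      exact (Nat.Prime.coprime_iff_not_dvd hp).mpr hpM
    -- By Bézout `e = 1 - x * p`, so `e` is 1 modulo `p` and 0 modulo `M`.
    set e : ℤ := y * M with he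
    have hr := isTransversal_of_not_dvd hp hM0 (e := e) hpM ⟨-x, by linear_combination hxy⟩
      (dvd_mul_left _ _)
    have hold := isOldComponent_sum_transversal hMN hr hf ((p + 1 : ℂ)⁻¹)
    refine ⟨_, hold, fun L hL h => ?_⟩
    set E := ((p + 1 : ℂ)⁻¹) • ∑ i : Option (Fin p),
      f ∣[k] (i.elim (partialInversion e) fun j => upperUnip ((j : ℕ) * M)) with hE
    have hp0 : (p : ℂ) ≠ 0 := by exact_mod_cast hp.ne_zero
    have hp1 : (p + 1 : ℂ) ≠ 0 := by exact_mod_cast Nat.succ_ne_zero p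
    have hEw : E ∣[k] partialInversion e = E := hold.invariant _ (hr.mem none)
    have hsum : (p + 1 : ℂ) • E
        = f ∣[k] partialInversion e + (p : ℂ) • translationAverage k (p * M) p f := by
      rw [hE, smul_inv_smul₀ hp1, Fintype.sum_option, translationAverage, hdiv, smul_inv_smul₀ hp0]
      rfl
    have key : f - translationAverage k (p * M) p f
        = (f - E) + (p : ℂ)⁻¹ • ((f - E) ∣[k] partialInversion e) := by
      rw [sub_eq_add_neg f E, SlashAction.add_slash, SlashAction.neg_slash, hEw]
      have h2 : translationAverage k (p * M) p f
          = (p : ℂ)⁻¹ • ((p + 1 : ℂ) • E - f ∣[k] partialInversion e) := by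
        rw [hsum, add_sub_cancel_left, inv_smul_smul₀ hp0]
      rw [h2]
      ext τ
      simp only [Pi.sub_apply, Pi.add_apply, Pi.smul_apply, Pi.neg_apply, smul_eq_mul]
      field_simp
      ring
    have hinv : SlashInvariantOn k (Gamma (p * M)) (f - E) :=
      (hf.sub (hold.invariant.mono (GammaUpper_anti hMN))).mono (Gamma_le_GammaUpper _)
    rw [key, sieve_add_smul, hinv.sieve_slash_partialInversion fun q hq => ?_] at h
    · exact (hinv.sieve _ L).eq_zero_of_add_smul_slash _ hp.one_lt h
    · obtain ⟨hqp, hqN, hne⟩ := hL q hq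
      -- Since `q ∣ M ∣ e`, the factor `q` missing from `N / q` is supplied by `e`.
      have hqM : q ∣ M :=
        (Nat.Coprime.dvd_mul_left ((Nat.coprime_primes hqp hp).mpr hne)).mp hqN
      obtain ⟨R, rfl⟩ := hqM
      rw [show p * (q * R) = q * (p * R) by ring, Nat.mul_div_cancel_left _ hqp.pos]
      exact ⟨y * R, by rw [he]; push_cast; ring⟩

theorem exists_sum_isOldComponent {N : ℕ} [NeZero N] (L : List ℕ) (hL : L.Nodup)
    (hprime : ∀ p ∈ L, p.Prime ∧ p ∣ N) {f : ℍ → ℂ} (hf : SlashInvariantOn k (GammaUpper N) f)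
    (h0 : sieve k N L f = 0) :
    ∃ e : ℕ → ℍ → ℂ, f = (L.map e).sum ∧ ∀ p ∈ L, IsOldComponent k N (N / p) f (e p) := by
  induction L generalizing f with
  | nil => exact ⟨0, by simpa [sieve] using h0, by simp⟩
  | cons p L ih =>
    rw [List.nodup_cons] at hL
    obtain ⟨hp, hpN⟩ := hprime p List.mem_cons_self
    have hprime' : ∀ q ∈ L, q.Prime ∧ q ∣ N := fun q hq => hprime q (List.mem_cons_of_mem _ hq)
    have hne : ∀ q ∈ L, q ≠ p := fun q hq hqp => hL.1 (hqp ▸ hq)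
    obtain ⟨E, hE, hsieve⟩ := exists_isOldComponent hp hpN hf
    have hdvd : N / p ∣ N := Nat.div_dvd_of_dvd hpN
    obtain ⟨e, he, hcomp⟩ := ih hL.2 hprime'
      (hf.sub (hE.invariant.mono (GammaUpper_anti hdvd)))
      (hsieve L (fun q hq => ⟨(hprime' q hq).1, (hprime' q hq).2, hne q hq⟩) h0)
    refine ⟨Function.update e p E, ?_, fun q hq => ?_⟩
    · rw [List.map_cons, List.sum_cons, Function.update_self,
        List.map_congr_left (g := e) fun q hq => Function.update_of_ne (hne q hq) _ _, ← he]
      abel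
    · rcases List.mem_cons.mp hq with rfl | hq
      · rwa [Function.update_self]
      · rw [Function.update_of_ne (hne q hq)]
        exact hE.sub (hcomp q hq)

/-! ### Effect of the sieve on Fourier expansions -/

theorem slash_upperUnip_apply (k : ℤ) (f : ℍ → ℂ) (t : ℤ) (τ : ℍ) :
    (f ∣[k] upperUnip t) τ = f (upperUnip t • τ) := by
  rw [ModularForm.SL_slash_apply]
  simp [UpperHalfPlane.denom, coe_upperUnip]

theorem coe_upperUnip_smul (t : ℤ) (τ : ℍ) : ((upperUnip t • τ : ℍ) : ℂ) = τ + t := by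
  rw [UpperHalfPlane.coe_specialLinearGroup_apply]
  simp [coe_upperUnip]

open Function.Periodic in
theorem qParam_upperUnip_smul {p M : ℕ} (hp : p ≠ 0) (hM : M ≠ 0) (j : ℕ) (τ : ℍ) :
    qParam ((p * M : ℕ) : ℝ) ((upperUnip (j * M) • τ : ℍ) : ℂ)
      = qParam ((p * M : ℕ) : ℝ) τ * Complex.exp (2 * Real.pi * Complex.I / p) ^ j := by
  have hp' : (p : ℂ) ≠ 0 := by exact_mod_cast hp
  have hM' : (M : ℂ) ≠ 0 := by exact_mod_cast hM
  rw [coe_upperUnip_smul, qParam, qParam, ← Complex.exp_nat_mul, ← Complex.exp_add]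
  congr 1
  push_cast
  field_simp

theorem sum_exp_pow {p : ℕ} (hp : p ≠ 0) (m : ℕ) :
    ∑ j : Fin p, (Complex.exp (2 * Real.pi * Complex.I / p) ^ (j : ℕ)) ^ m
      = if p ∣ m then (p : ℂ) else 0 := by
  have hζ := Complex.isPrimitiveRoot_exp p hp
  set ζ := Complex.exp (2 * Real.pi * Complex.I / p)
  rw [Finset.sum_congr rfl fun (j : Fin p) _ => show (ζ ^ (j : ℕ)) ^ m = (ζ ^ m) ^ (j : ℕ) from
    pow_right_comm ζ _ m, Fin.sum_univ_eq_sum_range fun j => (ζ ^ m) ^ j]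
  split_ifs with h
  · rw [(hζ.pow_eq_one_iff_dvd m).mpr h]
    simp
  · have h1 : ζ ^ m ≠ 1 := fun h' => h ((hζ.pow_eq_one_iff_dvd m).mp h')
    rw [geom_sum_eq h1, pow_right_comm, hζ.pow_eq_one]
    simp

-- Translation by `j * N / p` multiplies the `m`-th term by `ζ ^ (j * m)` with ζ a primitive `p`-th
-- root of unity; averaging over `j` keeps exactly the terms with `p ∣ m`.
open Function.Periodic in
theorem hasSum_sub_translationAverage {k : ℤ} {N p : ℕ} (hN : N ≠ 0) (hp : p ∣ N) {f : ℍ → ℂ}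
    {a : ℕ → ℂ} (h : ∀ τ : ℍ, HasSum (fun m => a m * qParam (N : ℝ) τ ^ m) (f τ)) (τ : ℍ) :
    HasSum (fun m => (if p ∣ m then 0 else a m) * qParam (N : ℝ) τ ^ m)
      ((f - translationAverage k N p f) τ) := by
  obtain ⟨M, rfl⟩ := hp
  have hp0 : p ≠ 0 := fun h => hN (by simp [h])
  have hM0 : M ≠ 0 := fun h => hN (by simp [h])
  have hp' : (p : ℂ) ≠ 0 := by exact_mod_cast hp0
  have key : HasSum (fun m => (p : ℂ)⁻¹ * ∑ j : Fin p, a m *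
      qParam ((p * M : ℕ) : ℝ) ((upperUnip ((j : ℕ) * M) • τ : ℍ) : ℂ) ^ m)
      (translationAverage k (p * M) p f τ) := by
    rw [translationAverage, Nat.mul_div_cancel_left M (Nat.pos_of_ne_zero hp0), Pi.smul_apply,
      Finset.sum_apply, smul_eq_mul]
    refine HasSum.mul_left _ (hasSum_sum fun j _ => ?_)
    rw [slash_upperUnip_apply]
    exact h _
  refine ((h τ).sub key).congr_fun fun m => ?_
  simp only [qParam_upperUnip_smul hp0 hM0, mul_pow, ← mul_assoc, ← Finset.mul_sum,
    sum_exp_pow hp0]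
  split_ifs
  · field_simp; ring
  · ring

open Function.Periodic in
theorem hasSum_sieve {k : ℤ} {N : ℕ} (hN : N ≠ 0) (L : List ℕ) (hL : ∀ p ∈ L, p ∣ N) {f : ℍ → ℂ}
    {a : ℕ → ℂ} (h : ∀ τ : ℍ, HasSum (fun m => a m * qParam (N : ℝ) τ ^ m) (f τ)) (τ : ℍ) :
    HasSum (fun m => (if ∃ p ∈ L, p ∣ m then 0 else a m) * qParam (N : ℝ) τ ^ m)
      (sieve k N L f τ) := by
  induction L generalizing f a with
  | nil => simpa [sieve] using h τ
  | cons p L ih =>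
    have := ih (fun q hq => hL q (List.mem_cons_of_mem _ hq))
      (hasSum_sub_translationAverage (k := k) hN (hL p List.mem_cons_self) h)
    rw [sieve]
    convert this using 3 with m
    simp only [List.mem_cons, exists_eq_or_imp]
    by_cases h1 : p ∣ m <;> simp [h1]

/-! ### Passage between Γ₀(M) and Γ⁰(M) -/

/-- The matrix `[1, 0; 0, M]`. -/
noncomputable def scaleMatrix (M : ℕ) [NeZero M] : GL (Fin 2) ℝ :=
  upperTri 1 0 M one_ne_zero (NeZero.ne M)

theorem det_scaleMatrix_pos (M : ℕ) [NeZero M] : 0 < (scaleMatrix M).det.val :=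
  det_upperTri_pos _ _ _ _ _

theorem scaleMatrix_mul_mapGL (M : ℕ) [NeZero M] {γ δ : SL(2, ℤ)} (h00 : γ 0 0 = δ 0 0)
    (h01 : γ 0 1 = M * δ 0 1) (h10 : δ 1 0 = M * γ 1 0) (h11 : γ 1 1 = δ 1 1) :
    scaleMatrix M * Matrix.SpecialLinearGroup.mapGL ℝ γ
      = Matrix.SpecialLinearGroup.mapGL ℝ δ * scaleMatrix M := by
  apply Units.ext
  rw [Units.val_mul, Units.val_mul, coe_mapGL_eq, coe_mapGL_eq, scaleMatrix, coe_upperTri]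
  ext i j
  fin_cases i <;> fin_cases j <;>
    simp [Matrix.mul_apply, Fin.sum_univ_two, h00, h01, h10, h11, mul_comm]

theorem SlashInvariantOn.slash_scaleMatrix {k : ℤ} {M : ℕ} [NeZero M] {f : ℍ → ℂ}
    (hf : SlashInvariantOn k (Gamma0 M) f) :
    SlashInvariantOn k (GammaUpper M) (f ∣[k] scaleMatrix M) := by
  intro γ hγ
  obtain ⟨b, hb⟩ := mem_GammaUpper.mp hγ
  have hdet := γ.det_coe
  rw [Matrix.det_fin_two] at hdet
  let δ : SL(2, ℤ) := ⟨!![γ 0 0, b; M * γ 1 0, γ 1 1], by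
    rw [Matrix.det_fin_two]; simp; rw [hb] at hdet; linear_combination hdet⟩
  have hδ : δ ∈ Gamma0 M := by
    rw [Gamma0_mem, ZMod.intCast_zmod_eq_zero_iff_dvd]
    exact dvd_mul_right _ _
  change (f ∣[k] scaleMatrix M) ∣[k] (Matrix.SpecialLinearGroup.mapGL ℝ γ) = _
  rw [← SlashAction.slash_mul,
    scaleMatrix_mul_mapGL M (γ := γ) (δ := δ) rfl hb rfl rfl, SlashAction.slash_mul]
  congr 1
  exact hf δ hδ

theorem SlashInvariantOn.slash_scaleMatrix_inv {k : ℤ} {M : ℕ} [NeZero M] {f : ℍ → ℂ}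
    (hf : SlashInvariantOn k (GammaUpper M) f) :
    SlashInvariantOn k (Gamma0 M) (f ∣[k] (scaleMatrix M)⁻¹) := by
  intro δ hδ
  rw [Gamma0_mem, ZMod.intCast_zmod_eq_zero_iff_dvd] at hδ
  obtain ⟨c, hc⟩ := hδ
  have hdet := δ.det_coe
  rw [Matrix.det_fin_two] at hdet
  let γ : SL(2, ℤ) := ⟨!![δ 0 0, M * δ 0 1; c, δ 1 1], by
    rw [Matrix.det_fin_two]; simp; rw [hc] at hdet; linear_combination hdet⟩
  have hγ : γ ∈ GammaUpper M := mem_GammaUpper.mpr (dvd_mul_right _ _)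
  have hmat : (scaleMatrix M)⁻¹ * Matrix.SpecialLinearGroup.mapGL ℝ δ
      = Matrix.SpecialLinearGroup.mapGL ℝ γ * (scaleMatrix M)⁻¹ := by
    rw [inv_mul_eq_iff_eq_mul, ← mul_assoc, eq_mul_inv_iff_mul_eq]
    exact (scaleMatrix_mul_mapGL M (γ := γ) (δ := δ) rfl rfl hc rfl).symm
  change (f ∣[k] (scaleMatrix M)⁻¹) ∣[k] (Matrix.SpecialLinearGroup.mapGL ℝ δ) = _
  rw [← SlashAction.slash_mul, hmat, SlashAction.slash_mul]
  congr 1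
  exact hf γ hγ

theorem heckeRep_mul_scaleMatrix {m : ℕ} (M : ℕ) [NeZero M] (i : HeckeIndex m) :
    heckeRep 1 i * scaleMatrix M = scaleMatrix M * heckeRep M i := by
  apply Units.ext
  rw [Units.val_mul, Units.val_mul, heckeRep, heckeRep, scaleMatrix, coe_upperTri, coe_upperTri,
    coe_upperTri]
  ext i j
  fin_cases i <;> fin_cases j <;> simp [Matrix.mul_apply, Fin.sum_univ_two, mul_comm]

theorem heckeScaled_slash_scaleMatrix (k : ℤ) (m M : ℕ) [NeZero M] (f : ℍ → ℂ) :
    heckeScaled k m M (f ∣[k] scaleMatrix M) = (heckeOp k m f) ∣[k] scaleMatrix M := by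
  rw [heckeOp_eq_heckeScaled, heckeScaled, heckeScaled, SlashAction.sum_slash]
  simp only [← SlashAction.slash_mul, heckeRep_mul_scaleMatrix]

theorem heckeOp_slash_scaleMatrix_inv (k : ℤ) (m M : ℕ) [NeZero M] (f : ℍ → ℂ) :
    heckeOp k m (f ∣[k] (scaleMatrix M)⁻¹) = (heckeScaled k m M f) ∣[k] (scaleMatrix M)⁻¹ := by
  have h := heckeScaled_slash_scaleMatrix k m M (f ∣[k] (scaleMatrix M)⁻¹)
  rw [← SlashAction.slash_mul, inv_mul_cancel, SlashAction.slash_one] at h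
  rw [h, ← SlashAction.slash_mul, mul_inv_cancel, SlashAction.slash_one]

theorem smul_slash_of_det_pos (k : ℤ) {g : GL (Fin 2) ℝ} (hg : 0 < g.det.val) (f : ℍ → ℂ) (c : ℂ) :
    (c • f) ∣[k] g = c • (f ∣[k] g) := by
  rw [ModularForm.smul_slash, UpperHalfPlane.σ, if_pos hg]
  rfl

theorem slash_scaleMatrix_apply (k : ℤ) (M : ℕ) [NeZero M] (f : ℍ → ℂ) (τ : ℍ) :
    (f ∣[k] scaleMatrix M) τ = (M : ℂ)⁻¹ * f (scaleMatrix M • τ) := by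
  have hM : (M : ℂ) ≠ 0 := by exact_mod_cast NeZero.ne M
  rw [scaleMatrix, slash_upperTri, Nat.cast_one, one_mul, ← zpow_add₀ hM]
  congr 1
  rw [show k - 1 + -k = -1 by ring, zpow_neg_one]

theorem coe_scaleMatrix_smul (M : ℕ) [NeZero M] (τ : ℍ) :
    ((scaleMatrix M • τ : ℍ) : ℂ) = τ / M := by
  rw [scaleMatrix, coe_upperTri_smul]
  simp

theorem slash_scaleMatrix_inv_apply (k : ℤ) (M : ℕ) [NeZero M] (f : ℍ → ℂ) (τ : ℍ) :
    (f ∣[k] (scaleMatrix M)⁻¹) τ = M * f ((scaleMatrix M)⁻¹ • τ) := by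
  have hM : (M : ℂ) ≠ 0 := by exact_mod_cast NeZero.ne M
  have h := slash_scaleMatrix_apply k M (f ∣[k] (scaleMatrix M)⁻¹) ((scaleMatrix M)⁻¹ • τ)
  rw [← SlashAction.slash_mul, inv_mul_cancel, SlashAction.slash_one, smul_inv_smul] at h
  rw [h, mul_inv_cancel_left₀ hM]

theorem coe_scaleMatrix_inv_smul (M : ℕ) [NeZero M] (τ : ℍ) :
    (((scaleMatrix M)⁻¹ • τ : ℍ) : ℂ) = M * τ := by
  have hM : (M : ℂ) ≠ 0 := by exact_mod_cast NeZero.ne M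
  have h := coe_scaleMatrix_smul M ((scaleMatrix M)⁻¹ • τ)
  rw [smul_inv_smul] at h
  rw [h]
  field_simp

/-! ### Cusps and growth conditions -/

/-- A rational matrix conjugates SL(2, ℤ) to an arithmetic group, which has the same cusps. -/
theorem isCusp_scaleMatrix_inv_smul (M : ℕ) [NeZero M] {c : OnePoint ℝ} (hc : IsCusp c 𝒮ℒ) :
    IsCusp ((scaleMatrix M)⁻¹ • c) 𝒮ℒ ∧ IsCusp (scaleMatrix M • c) 𝒮ℒ := by
  have hrat : ∀ g : GL (Fin 2) ℚ, IsCusp (g.map (Rat.castHom ℝ) • c) 𝒮ℒ := fun g => by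
    have := isArithmetic_conj_SL2Z g
    exact (Subgroup.IsArithmetic.isCusp_iff_isCusp_SL2Z _).mp (hc.smul _)
  let D : GL (Fin 2) ℚ := Matrix.GeneralLinearGroup.mkOfDetNeZero !![1, 0; 0, (M : ℚ)]
    (by simp [Matrix.det_fin_two, NeZero.ne M])
  have hD : D.map (Rat.castHom ℝ) = scaleMatrix M := by
    ext i j
    rw [scaleMatrix, coe_upperTri]
    fin_cases i <;> fin_cases j <;> simp [D, Matrix.GeneralLinearGroup.mkOfDetNeZero]
  refine ⟨?_, hD ▸ hrat D⟩
  have := hrat D⁻¹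
  rwa [map_inv, hD] at this

/-- The holomorphic functions that are bounded at all rational cusps. -/
def holomorphicBounded (k : ℤ) : Submodule ℂ (ℍ → ℂ) where
  carrier := {f | MDifferentiable (modelWithCornersSelf ℂ ℂ) (modelWithCornersSelf ℂ ℂ) f ∧
    ∀ c : OnePoint ℝ, IsCusp c 𝒮ℒ → c.IsBoundedAt f k}
  zero_mem' := ⟨(0 : ModularForm 𝒮ℒ k).holo', fun _ hc => (0 : ModularForm 𝒮ℒ k).bdd_at_cusps' hc⟩
  add_mem' hf hg := ⟨hf.1.add hg.1, fun c hc => (hf.2 c hc).add (hg.2 c hc)⟩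
  smul_mem' a f hf := ⟨hf.1.const_smul a, fun c hc g hg => by
    rw [ModularForm.smul_slash]
    exact (hf.2 c hc g hg).const_smul_left _⟩

/-- The functions that vanish at all rational cusps. -/
def zeroAtCusps (k : ℤ) : Submodule ℂ (ℍ → ℂ) where
  carrier := {f | ∀ c : OnePoint ℝ, IsCusp c 𝒮ℒ → c.IsZeroAt f k}
  zero_mem' := fun _ hc => (0 : CuspForm 𝒮ℒ k).zero_at_cusps' hc
  add_mem' hf hg := fun c hc => (hf c hc).add (hg c hc)
  smul_mem' a f hf := fun c hc g hg => by
    rw [ModularForm.smul_slash]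
    exact (hf c hc g hg).smul _

theorem slash_mem_holomorphicBounded {k : ℤ} {f : ℍ → ℂ} (hf : f ∈ holomorphicBounded k)
    {g : GL (Fin 2) ℝ} (hg : ∀ c, IsCusp c 𝒮ℒ → IsCusp (g • c) 𝒮ℒ) :
    f ∣[k] g ∈ holomorphicBounded k :=
  ⟨hf.1.slash k g, fun c hc => OnePoint.IsBoundedAt.smul_iff.mp (hf.2 _ (hg c hc))⟩

theorem slash_mem_zeroAtCusps {k : ℤ} {f : ℍ → ℂ} (hf : f ∈ zeroAtCusps k)
    {g : GL (Fin 2) ℝ} (hg : ∀ c, IsCusp c 𝒮ℒ → IsCusp (g • c) 𝒮ℒ) :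
    f ∣[k] g ∈ zeroAtCusps k :=
  fun c hc => OnePoint.IsZeroAt.smul_iff.mp (hf _ (hg c hc))

theorem isSlashStable_holomorphicBounded (k : ℤ) : IsSlashStable k (holomorphicBounded k) :=
  fun _ hf γ => slash_mem_holomorphicBounded hf fun _ hc => hc.smul_of_mem ⟨γ, rfl⟩

theorem isSlashStable_zeroAtCusps (k : ℤ) : IsSlashStable k (zeroAtCusps k) :=
  fun _ hf γ => slash_mem_zeroAtCusps hf fun _ hc => hc.smul_of_mem ⟨γ, rfl⟩

/-- The modular form for `Γ₀(M)` with a given underlying function. -/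
def modularFormOfMem {k : ℤ} {M : ℕ} [NeZero M] (f : ℍ → ℂ)
    (hf : SlashInvariantOn k (Gamma0 M) f) (hf' : f ∈ holomorphicBounded k) :
    ModularForm (Gamma0 M) k where
  toFun := f
  slash_action_eq' := by
    rintro _ ⟨γ, hγ, rfl⟩
    exact hf γ hγ
  holo' := hf'.1
  bdd_at_cusps' hc := hf'.2 _ ((Subgroup.IsArithmetic.isCusp_iff_isCusp_SL2Z _).mp hc)

theorem mem_holomorphicBounded {k : ℤ} {M : ℕ} [NeZero M] (f : ModularForm (Gamma0 M) k) :
    (f : ℍ → ℂ) ∈ holomorphicBounded k :=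
  ⟨f.holo', fun _ hc =>
    f.bdd_at_cusps' ((Subgroup.IsArithmetic.isCusp_iff_isCusp_SL2Z _).mpr hc)⟩

theorem isCuspForm_iff_mem_zeroAtCusps {k : ℤ} {M : ℕ} [NeZero M] (f : ModularForm (Gamma0 M) k) :
    f.IsCuspForm ↔ (f : ℍ → ℂ) ∈ zeroAtCusps k := by
  rw [ModularForm.isCuspForm_iff]
  exact ⟨fun h c hc => h ((Subgroup.IsArithmetic.isCusp_iff_isCusp_SL2Z _).mpr hc),
    fun h c hc => h c ((Subgroup.IsArithmetic.isCusp_iff_isCusp_SL2Z _).mp hc)⟩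

theorem ModularForm.slashInvariantOn {k : ℤ} {M : ℕ} (f : ModularForm (Gamma0 M) k) :
    SlashInvariantOn k (Gamma0 M) f := fun γ hγ => f.slash_action_eq' _ ⟨γ, hγ, rfl⟩

/-! ### The decomposition at level N -/

open Function.Periodic in
theorem sieve_slash_scaleMatrix_eq_zero {k : ℤ} {N : ℕ} [NeZero N] (f : ModularForm (Gamma0 N) k)
    (hf : ∀ m : ℕ, m.Coprime N → (qExpansion 1 f).coeff m = 0) :
    sieve k N N.primeFactors.toList ((f : ℍ → ℂ) ∣[k] scaleMatrix N) = 0 := by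
  have : Fact (IsCusp .infty ((Gamma0 N : Subgroup SL(2, ℤ)) : Subgroup (GL (Fin 2) ℝ))) :=
    ⟨Subgroup.isCusp_of_mem_strictPeriods (h := 1) one_pos (by simp)⟩
  have hsum : ∀ τ : ℍ, HasSum (fun m => ((N : ℂ)⁻¹ * (qExpansion 1 f).coeff m)
      * qParam (N : ℝ) τ ^ m) (((f : ℍ → ℂ) ∣[k] scaleMatrix N) τ) := fun τ => by
    rw [slash_scaleMatrix_apply]
    refine ((ModularForm.hasSum_qExpansion f (h := 1) one_pos
      (by simp) (scaleMatrix N • τ)).mul_left (N : ℂ)⁻¹).congr_fun fun m => ?_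
    rw [mul_assoc, coe_scaleMatrix_smul, qParam, qParam]
    congr 4
    push_cast
    ring
  ext τ
  have h := hasSum_sieve (k := k) (NeZero.ne N) N.primeFactors.toList
    (fun p hp => Nat.dvd_of_mem_primeFactors (Finset.mem_toList.mp hp)) hsum τ
  refine h.unique ?_
  refine hasSum_zero.congr_fun fun m => ?_
  split_ifs with hm
  · simp
  -- An index divisible by no prime factor of `N` is prime to `N`. This includes `m = 0` when `N =
  -- 1`, where the sieve is empty.
  · rw [hf m, mul_zero, zero_mul]
    refine Nat.Coprime.symm (Nat.coprime_of_dvd fun p hp hpN hpm => hm ⟨p, ?_, hpm⟩)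
    exact Finset.mem_toList.mpr (Nat.mem_primeFactors.mpr ⟨hp, hpN, NeZero.ne N⟩)

theorem exists_levelRaise_eq {k : ℤ} {N p : ℕ} [NeZero N] (hp : p.Prime) (hpN : p ∣ N)
    (h : p * (N / p) ∣ N) (f : ModularForm (Gamma0 N) k) {e : ℍ → ℂ}
    (he : IsOldComponent k N (N / p) ((f : ℍ → ℂ) ∣[k] scaleMatrix N) e) :
    ∃ g : ModularForm (Gamma0 (N / p)) k,
      (levelRaise hp.ne_zero h g : ℍ → ℂ) = e ∣[k] (scaleMatrix N)⁻¹ ∧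
      (f.IsCuspForm → g.IsCuspForm) ∧
      (∀ lam : ℕ → ℂ, IsHeckeEigen N k f lam → IsHeckeEigen N k g lam) := by
  have : NeZero (N / p) := ⟨(Nat.div_pos (Nat.le_of_dvd (NeZero.pos N) hpN) hp.pos).ne'⟩
  have hcusp : ∀ c, IsCusp c 𝒮ℒ → IsCusp ((scaleMatrix (N / p))⁻¹ • c) 𝒮ℒ := fun c hc =>
    (isCusp_scaleMatrix_inv_smul (N / p) hc).1
  have hcusp' : ∀ c, IsCusp c 𝒮ℒ → IsCusp (scaleMatrix N • c) 𝒮ℒ := fun c hc =>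
    (isCusp_scaleMatrix_inv_smul N hc).2
  have hp0 : (p : ℂ) ≠ 0 := by exact_mod_cast hp.ne_zero
  -- The factor `p` compares the normalizations: undoing the scaling yields `N * e(Nτ)` at level
  -- `N`, but `(N / p) * e(Nτ)` at level `N / p` evaluated at `pτ`.
  let g := modularFormOfMem ((p : ℂ) • (e ∣[k] (scaleMatrix (N / p))⁻¹))
    (he.invariant.slash_scaleMatrix_inv.smul _)
    (Submodule.smul_mem _ _ (slash_mem_holomorphicBounded
      (he.mem _ (isSlashStable_holomorphicBounded k)
        (slash_mem_holomorphicBounded (mem_holomorphicBounded f) hcusp')) hcusp))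
  refine ⟨g, ?_, fun hf => ?_, fun lam hlam m hm hmN => ?_⟩
  · ext τ
    rw [levelRaise_apply]
    change (p : ℂ) * (e ∣[k] (scaleMatrix (N / p))⁻¹) _ = _
    rw [slash_scaleMatrix_inv_apply, slash_scaleMatrix_inv_apply, ← mul_assoc, ← Nat.cast_mul,
      Nat.mul_div_cancel' hpN]
    congr 2
    ext
    rw [coe_scaleMatrix_inv_smul, coe_scaleMatrix_inv_smul, coe_upperTri_smul,
      Nat.cast_div hpN hp0]
    field_simp
    simp
    ring
  · rw [isCuspForm_iff_mem_zeroAtCusps] at hf ⊢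
    exact Submodule.smul_mem _ _ (slash_mem_zeroAtCusps
      (he.mem _ (isSlashStable_zeroAtCusps k) (slash_mem_zeroAtCusps hf hcusp')) hcusp)
  · have h1 : heckeScaled k m N ((f : ℍ → ℂ) ∣[k] scaleMatrix N)
        = lam m • ((f : ℍ → ℂ) ∣[k] scaleMatrix N) := by
      rw [heckeScaled_slash_scaleMatrix, hlam m hm hmN,
        smul_slash_of_det_pos k (det_scaleMatrix_pos N)]
    have h2 := he.hecke m hm hmN _ h1
    -- As `e` is invariant under the larger group Γ⁰(N/p), the step `N` in the representatives may
    -- be replaced by `N / p`, the one that conjugates to T_m at level `N / p`.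
    rw [heckeScaled_eq_of_dvd hm hmN (Nat.div_dvd_of_dvd hpN) he.invariant] at h2
    have hdet : 0 < ((scaleMatrix (N / p))⁻¹).det.val := by
      rw [map_inv, Units.val_inv_eq_inv_val]
      exact inv_pos.mpr (det_scaleMatrix_pos _)
    change heckeOp k m ((p : ℂ) • (e ∣[k] (scaleMatrix (N / p))⁻¹))
      = lam m • ((p : ℂ) • (e ∣[k] (scaleMatrix (N / p))⁻¹))
    rw [← smul_slash_of_det_pos k hdet, heckeOp_slash_scaleMatrix_inv, heckeScaled_smul, h2,
      ← smul_slash_of_det_pos k hdet, smul_comm]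

theorem theorem1 (N : ℕ) (hN : 0 < N) (k : ℤ) (f : ModularForm (Gamma0 N) k)
    (hf : ∀ m : ℕ, m.Coprime N → (qExpansion 1 f).coeff m = 0) :
    ∃ g : (p : N.primeFactors) → ModularForm (Gamma0 (N / p.1)) k,
      (f = ∑ p : N.primeFactors,
        levelRaise (Nat.prime_of_mem_primeFactors p.2).ne_zero
          (Nat.mul_div_cancel' (Nat.dvd_of_mem_primeFactors p.2)).dvd (g p)) ∧
      (f.IsCuspForm → ∀ p, (g p).IsCuspForm) ∧
      (∀ lam : ℕ → ℂ, IsHeckeEigen N k f lam → ∀ p, IsHeckeEigen N k (g p) lam) := by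
  have : NeZero N := ⟨hN.ne'⟩
  obtain ⟨e, hsum, he⟩ := exists_sum_isOldComponent N.primeFactors.toList (Finset.nodup_toList _)
    (fun p hp => ⟨Nat.prime_of_mem_primeFactors (Finset.mem_toList.mp hp),
      Nat.dvd_of_mem_primeFactors (Finset.mem_toList.mp hp)⟩)
    f.slashInvariantOn.slash_scaleMatrix (sieve_slash_scaleMatrix_eq_zero f hf)
  choose g hg hcusp hhecke using fun p : N.primeFactors =>
    exists_levelRaise_eq (Nat.prime_of_mem_primeFactors p.2) (Nat.dvd_of_mem_primeFactors p.2)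
      (Nat.mul_div_cancel' (Nat.dvd_of_mem_primeFactors p.2)).dvd f
      (he p.1 (Finset.mem_toList.mpr p.2))
  refine ⟨g, ?_, fun h p => hcusp p h, fun lam h p => hhecke p lam h⟩
  apply DFunLike.coe_injective
  rw [FunLike.coe_sum]
  simp only [hg]
  rw [← SlashAction.sum_slash, Finset.sum_coe_sort N.primeFactors e, ← Finset.sum_map_toList,
    ← hsum, ← SlashAction.slash_mul, mul_inv_cancel, SlashAction.slash_one]
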